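/- Let $\overline{\mathbb D}\subset\mathbb C$ be the closed and $\mathbb D$ the open unit disk, and let $n\ge 2$. An \emph{arc} in the polydisk $\mathbb D^n$ is a map $\phi=(\phi_1,\dots,\phi_n):\overline{\mathbb D}\to\mathbb D^n$ that is holomorphic in a neighbourhood of $\overline{\mathbb D}$; spaces of arcs carry the topology of the supremum metric. Let $\mathrm{arc}(0\in\mathbb D)^n$ be the space of arcs $\phi$ in $\mathbb D^n$ with $\phi(0)=0$, let $\mathrm{sharc}(0\in\mathbb D^n)$ be the space of arcs $\phi$ in $\mathbb D^n$ with $\phi^{-1}(0)=\{0\}$, and let $$\mathrm{sharc}^*(0\in\mathbb D^n)=\{\phi\in\mathrm{arc}(0\in\mathbb D)^n:\ \phi^{-1}(Z_2)=\{0\}\},\qquad Z_2=\bigcup_{i\ne j}\{x\in\mathbb D^n: x_i=x_j=0\}$$ (preimages taken as sets). A set $A$ of arcs is \emph{strongly irreducible} if for every finite subset $P\subset A$ there are a (finite dimensional) irreducible complex space $V$ and a holomorphic map $F:V\times\overline{\mathbb D}\to\mathbb D^n$ (a holomorphic family of arcs) such that all arcs $F(v,\cdot)$, $v\in V$, are in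 $A$ and every element of $P$ is among them. (1) The space $\mathrm{sharc}^*(0\in\mathbb D^n)$ is connected, strongly irreducible, and a dense subset of $\mathrm{arc}(0\in\mathbb D)^n$. The space $\mathrm{sharc}(0\in\mathbb D^n)$ is connected. (2) Let $m\ge 1$, let $\epsilon\in\mathbb C$ be a primitive $m$-th root of unity, and let $\rho_1,\dots,\rho_n:\mathbb Z/m\to\mathbb C^*$ be characters. Denote by a superscript $\rho$ the subset of the arcs that are $\rho$-equivariant, that is, that satisfy $\phi_i(\epsilon^k t)=\rho_i(k)\,\phi_i(t)$ for all $k\in\mathbb Z/m$, all $t\in\overline{\mathbb D}$ and all $i$. Then $\mathrm{sharc}^*(0\in\mathbb D^n)^\rho$ is connected, strongly irreducible, and a dense subset of $(\mathrm{arc}(0\in\mathbb D)^n)^\rho$, and $\mathrm{sharc}(0\in\mathbb D^n)^\rho$ is connected. -/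

import Mathlib

open Set

namespace ArcSpace

/-! ### Reduced complex analytic spaces -/

/-- `A` is a closed analytic subset of the open set `Ω ⊆ ℂ^N`: near every point of `Ω` it is the
common zero set of finitely many holomorphic functions. -/
def IsAnalyticSubset {N : ℕ} (Ω A : Set (Fin N → ℂ)) : Prop :=
  A ⊆ Ω ∧ ∀ x ∈ Ω, ∃ U : Set (Fin N → ℂ), IsOpen U ∧ x ∈ U ∧ U ⊆ Ω ∧
    ∃ (k : ℕ) (f : (Fin N → ℂ) → (Fin k → ℂ)),
      AnalyticOnNhd ℂ f U ∧ A ∩ U = {y ∈ U | f y = 0}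

/-- A chart: a homeomorphism from an open subset `source` of `V` onto a closed analytic subset of
an open set `domain ⊆ ℂ^dim`. Only the values of `toFun` on `source` matter. -/
structure AnalyticChart (V : Type) [TopologicalSpace V] where
  dim : ℕ
  source : Set V
  isOpen_source : IsOpen source
  domain : Set (Fin dim → ℂ)
  isOpen_domain : IsOpen domain
  toFun : V → (Fin dim → ℂ)
  isEmbedding : Topology.IsEmbedding (source.domRestrict toFun)
  isAnalyticSubset_image : IsAnalyticSubset domain (toFun '' source)

/-- The change of coordinates from `c` to `d` is holomorphic, i.e. locally the restriction of a
holomorphic map between open subsets of the ambient affine spaces. -/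
def AnalyticChart.HolomorphicTransition {V : Type} [TopologicalSpace V]
    (c d : AnalyticChart V) : Prop :=
  ∀ x ∈ c.source ∩ d.source, ∃ (U : Set (Fin c.dim → ℂ)) (g : (Fin c.dim → ℂ) → (Fin d.dim → ℂ)),
    IsOpen U ∧ c.toFun x ∈ U ∧ AnalyticOnNhd ℂ g U ∧
      ∀ y ∈ c.source ∩ d.source, c.toFun y ∈ U → d.toFun y = g (c.toFun y)

/-- The structure of a (reduced) complex space on a Hausdorff, second countable space `V`: an atlas
of local models, i.e. of closed analytic subsets of open sets in affine spaces, with holomorphic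
changes of coordinates. -/
structure ComplexSpace (V : Type) [TopologicalSpace V] where
  t2Space : T2Space V
  secondCountable : SecondCountableTopology V
  atlas : Set (AnalyticChart V)
  cover : ∀ x : V, ∃ c ∈ atlas, x ∈ c.source
  compatible : ∀ c ∈ atlas, ∀ d ∈ atlas, c.HolomorphicTransition d

namespace ComplexSpace

variable {V : Type} [TopologicalSpace V] (S : ComplexSpace V)

/-- Closed analytic subsets of a complex space. -/
def IsAnalyticSet (Y : Set V) : Prop :=
  ∀ c ∈ S.atlas, IsAnalyticSubset c.domain (c.toFun '' (Y ∩ c.source))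

/-- A complex space is irreducible if it is nonempty and is not the union of two proper closed
analytic subsets. (Such a space is pure dimensional, hence automatically finite dimensional.) -/
def IsIrreducible : Prop :=
  Nonempty V ∧ ∀ Y₁ Y₂ : Set V, S.IsAnalyticSet Y₁ → S.IsAnalyticSet Y₂ →
    Y₁ ∪ Y₂ = univ → Y₁ = univ ∨ Y₂ = univ

end ComplexSpace

/-! ### Arcs -/

/-- The closed unit disk in `ℂ`. -/
abbrev ClosedDisk : Type := Metric.closedBall (0 : ℂ) 1

/-- The origin of the closed unit disk. -/
def origin : ClosedDisk := ⟨0, by simp⟩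

/-- The space of arcs in `X ⊆ ℂ^n`: maps from the closed unit disk to `X` that are the restriction
of a map holomorphic in a neighbourhood of the closed disk. It is a subset of the space of
continuous maps `C(ClosedDisk, ℂ^n)`, whose topology is that of the supremum metric. -/
def arc {n : ℕ} (X : Set (Fin n → ℂ)) : Set C(ClosedDisk, Fin n → ℂ) :=
  {φ | (∃ f : ℂ → (Fin n → ℂ), AnalyticOnNhd ℂ f (Metric.closedBall 0 1) ∧
      ∀ t : ClosedDisk, φ t = f t) ∧ ∀ t, φ t ∈ X}

/-- The space of short arcs on `Z ⊆ X`: the arcs in `X` that meet `Z` at `t = 0` and nowhere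
else. -/
def sharc {n : ℕ} (Z X : Set (Fin n → ℂ)) : Set C(ClosedDisk, Fin n → ℂ) :=
  {φ ∈ arc X | φ ⁻¹' Z = {origin}}

/-- A family of arcs `F`, given by its classifying map, is holomorphic if `(v, t) ↦ F v t` is
holomorphic on `V × ClosedDisk`: around each of its points it is, in charts of `V`, the restriction
of a map holomorphic on an open subset of `ℂ^dim × ℂ` (in particular, at boundary points of the
disk it extends holomorphically across the boundary). -/
def ComplexSpace.IsHolomorphicFamily {V : Type} [TopologicalSpace V] (S : ComplexSpace V) {n : ℕ}
    (F : V → C(ClosedDisk, Fin n → ℂ)) : Prop :=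
  ∀ c ∈ S.atlas, ∀ v ∈ c.source, ∀ t : ClosedDisk,
    ∃ (U : Set ((Fin c.dim → ℂ) × ℂ)) (G : (Fin c.dim → ℂ) × ℂ → (Fin n → ℂ)),
      IsOpen U ∧ (c.toFun v, (t : ℂ)) ∈ U ∧ AnalyticOnNhd ℂ G U ∧
        ∀ w ∈ c.source, ∀ s : ClosedDisk, (c.toFun w, (s : ℂ)) ∈ U →
          F w s = G (c.toFun w, (s : ℂ))

/-- A set `A` of arcs is strongly irreducible if every finite subset `P` of `A` lies in the image
of the classifying map of a holomorphic family of arcs in `A` that is parametrized by an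
irreducible complex space. -/
def StronglyIrreducible {n : ℕ} (A : Set C(ClosedDisk, Fin n → ℂ)) : Prop :=
  ∀ P : Set C(ClosedDisk, Fin n → ℂ), P.Finite → P ⊆ A →
    ∃ (V : Type) (_ : TopologicalSpace V) (S : ComplexSpace V)
      (F : V → C(ClosedDisk, Fin n → ℂ)),
      S.IsIrreducible ∧ S.IsHolomorphicFamily F ∧ range F ⊆ A ∧ P ⊆ range F

/-! ### The polydisk -/

/-- The open unit polydisk in `ℂ^n`. -/
def polydisk (n : ℕ) : Set (Fin n → ℂ) := {x | ∀ i, ‖x i‖ < 1}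

/-- The union of the codimension 2 coordinate subspaces `x i = x j = 0` of the polydisk. -/
def codimTwoStrata (n : ℕ) : Set (Fin n → ℂ) :=
  {x ∈ polydisk n | ∃ i j, i ≠ j ∧ x i = 0 ∧ x j = 0}

/-- The arcs in the polydisk that are centered at the origin, i.e. the `n`-tuples of arcs in the
disk that map `0` to `0`. -/
def arcZero (n : ℕ) : Set C(ClosedDisk, Fin n → ℂ) :=
  {φ ∈ arc (polydisk n) | ∀ i, φ origin i = 0}

/-- The short arcs on `0` in the polydisk. -/
def sharcZero (n : ℕ) : Set C(ClosedDisk, Fin n → ℂ) :=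
  sharc {0} (polydisk n)

/-- The arcs through the origin that meet the codimension 2 coordinate subspaces at `t = 0`
only. -/
def sharcStar (n : ℕ) : Set C(ClosedDisk, Fin n → ℂ) :=
  {φ ∈ arcZero n | φ ⁻¹' codimTwoStrata n = {origin}}

/-- The equivariant maps, where `ℤ/m` acts on the disk by `t ↦ ε^k t` and on the `i`-th coordinate
of the target by the character `ρ i`. -/
def Equivariant {n m : ℕ} (ε : ℂ) (ρ : Fin n → (Multiplicative (ZMod m) →* ℂˣ)) :
    Set C(ClosedDisk, Fin n → ℂ) :=
  {φ | ∀ (k : ZMod m) (s t : ClosedDisk), (s : ℂ) = ε ^ k.val * (t : ℂ) →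
    ∀ i, φ s i = (ρ i (Multiplicative.ofAdd k) : ℂ) * φ t i}

end ArcSpace

namespace ArcSpace

/-! An equivariant arc centred at 0 has components t^{a_i} g_i(t^m) with 1 ≤ a_i ≤ m and g_i
holomorphic on the closed disk (`exists_eq_pow_mul_of_mem`). Each g_i is c · ∏ (s − α_j) · exp h
with any sufficiently large number of factors (`exists_eq_mul_prod_mul_exp`), so finitely many arcs
share one shape and differ only in c, α_j and h. Interpolating these data by polynomials in one
parameter v gives a holomorphic family through all of them. If the polynomials for c and α_j are
nonzero and pairwise distinct, then for all but finitely many v no two components vanish together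
off t = 0. A nowhere vanishing factor e(v) keeps the values in the polydisk over a planar convex
domain (`exists_scaling`), and this domain minus finitely many points is connected, hence
irreducible. The resulting `exists_family` gives both connectedness and strong irreducibility.

For density, generic small constants added to the g_i destroy the common zeros
(`exists_add_const_no_common_zeros`). Finally `sharcZero` lies between `sharcStar` and its closure,
so it is connected too. The statement without a group action is the case m = 1. -/

/-! ### Holomorphic functions on the closed disk: symmetry and factorization. -/

theorem exists_ball_subset_of_closedBall_subset {O : Set ℂ} (hO : IsOpen O)
    (h : Metric.closedBall (0 : ℂ) 1 ⊆ O) : ∃ R : ℝ, 1 < R ∧ Metric.ball (0 : ℂ) R ⊆ O := by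
  obtain ⟨δ, hδ, hsub⟩ :=
    (isCompact_closedBall (0 : ℂ) 1).exists_thickening_subset_open hO h
  rw [thickening_closedBall hδ zero_le_one] at hsub
  exact ⟨δ + 1, by linarith, hsub⟩

theorem exists_ball_analyticOnNhd {f : ℂ → ℂ}
    (hf : AnalyticOnNhd ℂ f (Metric.closedBall 0 1)) :
    ∃ R : ℝ, 1 < R ∧ AnalyticOnNhd ℂ f (Metric.ball 0 R) :=
  exists_ball_subset_of_closedBall_subset (isOpen_analyticAt ℂ f) hf

/-- A power series that converges absolutely on a disk is analytic there. -/
theorem analyticOnNhd_tsum_of_summable {c : ℕ → ℂ} {ρ : ℝ}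
    (h : ∀ z : ℂ, ‖z‖ < ρ → Summable fun k => c k * z ^ k) :
    AnalyticOnNhd ℂ (fun z => ∑' k, c k * z ^ k) (Metric.ball 0 ρ) := by
  intro z hz
  have hz' : ‖z‖ < ρ := by simpa using hz
  obtain ⟨r, hzr, hrρ⟩ := exists_between hz'
  have hr0 : 0 ≤ r := (norm_nonneg z).trans hzr.le
  have hsum : Summable fun k => ‖c k * (r : ℂ) ^ k‖ :=
    (h r (by simpa [abs_of_nonneg hr0] using hrρ)).norm
  have hdiff : DifferentiableOn ℂ (fun z => ∑' k, c k * z ^ k) (Metric.ball 0 r) := by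
    refine Complex.differentiableOn_tsum_of_summable_norm hsum (fun k => by fun_prop)
      Metric.isOpen_ball fun k w hw => ?_
    have hw' : ‖w‖ < r := by simpa using hw
    simp only [norm_mul, norm_pow, Complex.norm_real, Real.norm_eq_abs, abs_of_nonneg hr0]
    gcongr
  exact hdiff.analyticAt (Metric.isOpen_ball.mem_nhds (by simpa using hzr))

/-- A function on the disk that transforms under rotation by `ε` with the character `ε ^ a` is
`t ^ a` times a function of `t ^ m`. -/
theorem exists_eq_pow_mul_comp_pow {m : ℕ} (hm : 0 < m) {ε : ℂ} (hε : IsPrimitiveRoot ε m)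
    {a : ℕ} (ham : a ≤ m) {f : ℂ → ℂ}
    (hf : AnalyticOnNhd ℂ f (Metric.closedBall 0 1)) (hf0 : f 0 = 0)
    (heq : ∀ t : ℂ, ‖t‖ ≤ 1 → f (ε * t) = ε ^ a * f t) :
    ∃ g : ℂ → ℂ, AnalyticOnNhd ℂ g (Metric.closedBall 0 1) ∧
      ∀ t : ℂ, ‖t‖ ≤ 1 → f t = t ^ a * g (t ^ m) := by
  obtain ⟨R, hR, hfR⟩ := exists_ball_analyticOnNhd hf
  obtain ⟨c, hc⟩ : ∃ c : ℕ → ℂ, ∀ t : ℂ, ‖t‖ < R → HasSum (fun k => c k * t ^ k) (f t) := by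
    refine ⟨fun k => (k.factorial : ℂ)⁻¹ * iteratedDeriv k f 0, fun t ht => ?_⟩
    have := Complex.hasSum_taylorSeries_on_ball (c := 0) (r := R) (z := t) (f := f)
      hfR.differentiableOn (by simpa using ht)
    simp only [sub_zero, smul_eq_mul] at this
    convert! this using 2 with k
    ring
  -- Needed when a = m: the exponent 0 is then congruent to a but is not of the form a + m j.
  have hc0 : c 0 = 0 := by
    have h1 := hc 0 (by simp; linarith)
    rw [hf0] at h1
    have h2 := hasSum_single (f := fun k => c k * (0 : ℂ) ^ k) 0 (by intro k hk; simp [hk])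
    simpa using h2.unique h1
  have hε1 : ‖ε‖ = 1 := hε.norm'_eq_one hm.ne'
  have hε0 : ε ≠ 0 := hε.ne_zero hm.ne'
  have hrot : ∀ (j : ℕ) (t : ℂ), ‖t‖ ≤ 1 → f (ε ^ j * t) = ε ^ (a * j) * f t := by
    intro j
    induction j with
    | zero => simp
    | succ j ih =>
      intro t ht
      rw [pow_succ', mul_assoc, heq _ (by simpa [hε1] using ht), ih t ht, mul_add, pow_add]
      ring
  -- only the exponents congruent to `a` modulo `m` contribute
  have havg : ∀ t : ℂ, ‖t‖ ≤ 1 →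
      HasSum (fun k => (if (ε ^ k = ε ^ a) then c k else 0) * t ^ k) (f t) := by
    intro t ht
    have h1 : ∀ j ∈ Finset.range m, HasSum
        (fun k => (m : ℂ)⁻¹ * ((ε ^ (a * j))⁻¹ * (c k * (ε ^ j * t) ^ k)))
        ((m : ℂ)⁻¹ * ((ε ^ (a * j))⁻¹ * f (ε ^ j * t))) := fun j _ =>
      ((hc _ (by simp [hε1]; linarith)).mul_left _).mul_left _
    have h2 := hasSum_sum h1
    have hm' : (m : ℂ) ≠ 0 := by exact_mod_cast hm.ne'
    convert h2 using 1
    · funext k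
      have hk : ∀ j, (m : ℂ)⁻¹ * ((ε ^ (a * j))⁻¹ * (c k * (ε ^ j * t) ^ k))
          = (m : ℂ)⁻¹ * c k * t ^ k * (ε ^ k / ε ^ a) ^ j := by
        intro j
        rw [div_pow, mul_pow, ← pow_mul, ← pow_mul, ← pow_mul, mul_comm j k]
        field_simp
      simp only [hk, ← Finset.mul_sum]
      split_ifs with h
      · rw [h, div_self (pow_ne_zero _ hε0)]
        simp
        field_simp
      -- The ratio is an m-th root of unity other than 1, so its powers sum to zero.
      · have hne : ε ^ k / ε ^ a ≠ 1 := by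
          rwa [Ne, div_eq_one_iff_eq (pow_ne_zero _ hε0)]
        have hz := geom_sum_mul (ε ^ k / ε ^ a) m
        rw [div_pow, ← pow_mul, ← pow_mul, mul_comm k, mul_comm a, pow_mul, pow_mul,
          hε.pow_eq_one] at hz
        simp only [one_pow, div_one, sub_self, mul_eq_zero, sub_eq_zero, hne, or_false] at hz
        rw [hz]; simp
    · rw [Finset.sum_congr rfl (g := fun _ => (m : ℂ)⁻¹ * f t)]
      · simp; field_simp
      · intro j _
        rw [hrot j t ht]
        field_simp
  have hinj : Function.Injective fun j : ℕ => a + m * j := fun i j hij => by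
    simpa [hm.ne'] using hij
  have hsum : ∀ s : ℂ, ‖s‖ < R ^ m → Summable fun j => c (a + m * j) * s ^ j := by
    intro s hs
    rcases eq_or_ne s 0 with rfl | hs0
    · exact summable_of_ne_finset_zero (s := {0}) (by intro b hb; simp at hb; simp [hb])
    -- At s = t^m the series is, up to the factor t^{-a}, a subseries of the Taylor series of f at
    -- t.
    obtain ⟨t, rfl⟩ := IsAlgClosed.exists_pow_nat_eq s hm
    have ht : ‖t‖ < R := by
      rw [norm_pow] at hs
      exact lt_of_pow_lt_pow_left₀ m (by linarith) hs
    have ht0 : t ≠ 0 := by rintro rfl; simp [hm.ne'] at hs0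
    have h1 := ((hc t ht).summable.comp_injective hinj).mul_left (t ^ a)⁻¹
    refine h1.congr fun j => ?_
    simp only [Function.comp, pow_add, pow_mul]
    field_simp
  refine ⟨fun s => ∑' j, c (a + m * j) * s ^ j,
    (analyticOnNhd_tsum_of_summable hsum).mono
      (Metric.closedBall_subset_ball (one_lt_pow₀ hR hm.ne')), fun t ht => ?_⟩
  have htm : ‖t ^ m‖ < R ^ m := by
    rw [norm_pow]
    exact (pow_le_one₀ (norm_nonneg t) ht).trans_lt (one_lt_pow₀ hR hm.ne')
  have h1 := (hsum _ htm).hasSum.mul_left (t ^ a)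
  refine (hinj.hasSum_iff ?_).2 (havg t ht) |>.unique ?_
  · intro k hk
    split_ifs with h
    · rcases Nat.eq_zero_or_pos k with rfl | hk0
      · simp [hc0]
      · exfalso
        have hmod : k % m = a % m := by
          rwa [(hε.isOfFinOrder hm.ne').pow_inj_mod, ← hε.eq_orderOf] at h
        have hak : a ≤ k := by
          by_contra! hlt
          rw [Nat.mod_eq_of_lt (hlt.trans_le ham)] at hmod
          rcases ham.eq_or_lt with rfl | hlt'
          · simp at hmod; omega
          · rw [Nat.mod_eq_of_lt hlt'] at hmod; omega
        obtain ⟨j, hj⟩ := (Nat.modEq_iff_dvd' hak).1 (show a ≡ k [MOD m] from hmod.symm)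
        exact hk ⟨j, by simp only; omega⟩
    · simp
  · convert! h1 using 2 with j
    have : ε ^ (a + m * j) = ε ^ a := by
      rw [pow_add, pow_mul, hε.pow_eq_one]; simp
    simp only [Function.comp, this, if_true, pow_add, pow_mul]
    ring

/-- A nowhere vanishing holomorphic function on the closed disk is an exponential. -/
theorem exists_eq_exp {u : ℂ → ℂ} (hu : AnalyticOnNhd ℂ u (Metric.closedBall 0 1))
    (hu0 : ∀ z ∈ Metric.closedBall (0 : ℂ) 1, u z ≠ 0) :
    ∃ h : ℂ → ℂ, AnalyticOnNhd ℂ h (Metric.closedBall 0 1) ∧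
      ∀ z ∈ Metric.closedBall (0 : ℂ) 1, u z = Complex.exp (h z) := by
  have hO : IsOpen {z | AnalyticAt ℂ u z ∧ u z ≠ 0} := by
    rw [isOpen_iff_mem_nhds]
    rintro z ⟨hz, hz0⟩
    exact hz.eventually_analyticAt.and (hz.continuousAt.eventually_ne hz0)
  obtain ⟨R, hR, hsub⟩ :=
    exists_ball_subset_of_closedBall_subset hO fun z hz => ⟨hu z hz, hu0 z hz⟩
  have hd : ∀ z ∈ Metric.ball (0 : ℂ) R, DifferentiableAt ℂ u z := fun z hz =>
    (hsub hz).1.differentiableAt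
  have hdiff : DifferentiableOn ℂ (fun z => deriv u z / u z) (Metric.ball 0 R) := fun z hz =>
    ((hsub hz).1.deriv.differentiableAt.div (hd z hz) (hsub hz).2).differentiableWithinAt
  have h0 : (0 : ℂ) ∈ Metric.ball (0 : ℂ) R := by simp; linarith
  -- A logarithm of u is a primitive of u'/u, which exists on a ball, normalized at 0; then u ·
  -- exp(−h) has derivative zero.
  obtain ⟨h, hh0, hh⟩ := hdiff.isExactOn_ball.with_val_at 0 (Complex.log (u 0))
  have hcb : Metric.closedBall (0 : ℂ) 1 ⊆ Metric.ball 0 R := Metric.closedBall_subset_ball hR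
  have hha : AnalyticOnNhd ℂ h (Metric.ball 0 R) :=
    DifferentiableOn.analyticOnNhd
      (fun z hz => (hh z hz).differentiableAt.differentiableWithinAt) Metric.isOpen_ball
  refine ⟨h, hha.mono hcb, fun z hz => ?_⟩
  have hder : ∀ w ∈ Metric.ball (0 : ℂ) R,
      HasDerivAt (fun w => u w * Complex.exp (-h w)) 0 w := by
    intro w hw
    convert! (hd w hw).hasDerivAt.mul (hh w hw).neg.cexp using 1
    have := (hsub hw).2
    field_simp
    ring
  have hconst := Metric.isOpen_ball.is_const_of_deriv_eq_zero
    (convex_ball (0 : ℂ) R).isPreconnected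
    (fun w hw => (hder w hw).differentiableAt.differentiableWithinAt)
    (fun w hw => (hder w hw).deriv) (hcb hz) h0
  simp only [hh0, Complex.exp_neg, Complex.exp_log (hsub h0).2] at hconst
  rw [mul_inv_cancel₀ (hsub h0).2] at hconst
  exact eq_of_mul_inv_eq_one hconst

/-- By compactness infinitely many zeros would accumulate in the disk, and the identity theorem
would make g vanish there. The last clause provides finite orders of vanishing. -/
theorem zeros_finite_or_eqOn_zero {g : ℂ → ℂ}
    (hg : AnalyticOnNhd ℂ g (Metric.closedBall 0 1)) :
    (∀ z ∈ Metric.closedBall (0 : ℂ) 1, g z = 0) ∨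
      ({z ∈ Metric.closedBall (0 : ℂ) 1 | g z = 0}.Finite ∧
        ∀ z ∈ Metric.closedBall (0 : ℂ) 1, ¬∀ᶠ w in nhds z, g w = 0) := by
  have hpre : IsPreconnected (Metric.closedBall (0 : ℂ) 1) :=
    (convex_closedBall _ _).isPreconnected
  by_cases hz : ∃ z ∈ Metric.closedBall (0 : ℂ) 1, ∃ᶠ w in nhdsWithin z {z}ᶜ, g w = 0
  · obtain ⟨z, hz, hfr⟩ := hz
    exact Or.inl (hg.eqOn_zero_of_preconnected_of_frequently_eq_zero hpre hz hfr)
  · right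
    push Not at hz
    constructor
    · by_contra hinf
      obtain ⟨z, hz1, hacc⟩ := Set.Infinite.exists_accPt_of_subset_isCompact hinf
        (isCompact_closedBall (0 : ℂ) 1) (fun z hz => hz.1)
      rw [accPt_iff_frequently_nhdsNE] at hacc
      exact (hacc.mono fun w hw => hw.2) (hz z hz1)
    · intro z hz1 hev
      exact ((hev.filter_mono nhdsWithin_le_nhds).frequently) (hz z hz1)

/-- Division of a holomorphic function on the closed disk by its zeros. -/
theorem exists_eq_prod_mul {g : ℂ → ℂ} (hg : AnalyticOnNhd ℂ g (Metric.closedBall 0 1))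
    (hne : ¬∀ z ∈ Metric.closedBall (0 : ℂ) 1, g z = 0) :
    ∃ (s : Multiset ℂ) (u : ℂ → ℂ), AnalyticOnNhd ℂ u (Metric.closedBall 0 1) ∧
      (∀ z ∈ Metric.closedBall (0 : ℂ) 1, u z ≠ 0) ∧
      ∀ z ∈ Metric.closedBall (0 : ℂ) 1, g z = (s.map fun α => z - α).prod * u z := by
  obtain ⟨hfin, hloc⟩ := (zeros_finite_or_eqOn_zero hg).resolve_left hne
  induction hk : {z ∈ Metric.closedBall (0 : ℂ) 1 | g z = 0}.ncard generalizing g with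
  | zero =>
    refine ⟨0, g, hg, fun z hz h0 => ?_, fun z _ => by simp⟩
    rw [Set.ncard_eq_zero hfin] at hk
    exact hk.subset (⟨hz, h0⟩ : z ∈ {z ∈ Metric.closedBall (0 : ℂ) 1 | g z = 0})
  | succ k ih =>
    obtain ⟨z₀, hz₀, hgz₀⟩ := Set.nonempty_of_ncard_ne_zero (hk.trans_ne k.succ_ne_zero)
    obtain ⟨N, g₁, hg₁, hg₁0, hev⟩ :=
      (hg z₀ hz₀).exists_eventuallyEq_pow_smul_nonzero_iff.2 (hloc z₀ hz₀)
    -- Dividing by the full power of z − z₀ removes z₀ from the zero set, so the induction runs on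
    -- the number of distinct zeros.
    set G : ℂ → ℂ := Function.update (fun z => g z / (z - z₀) ^ N) z₀ (g₁ z₀) with hG
    have hGev : G =ᶠ[nhds z₀] g₁ := by
      filter_upwards [hev] with z hz
      rcases eq_or_ne z z₀ with rfl | h
      · simp [hG]
      · rw [hG, Function.update_of_ne h, hz, smul_eq_mul,
          mul_div_cancel_left₀ _ (pow_ne_zero _ (sub_ne_zero.2 h))]
    have hGne : ∀ z, z ≠ z₀ → G z = g z / (z - z₀) ^ N := fun z h => by
      rw [hG, Function.update_of_ne h]
    have hG0 : G z₀ = g₁ z₀ := by simp [hG]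
    have hGa : AnalyticOnNhd ℂ G (Metric.closedBall 0 1) := by
      intro z hz
      rcases eq_or_ne z z₀ with rfl | h
      · exact hg₁.congr hGev.symm
      · have h1 : AnalyticAt ℂ (fun z => g z / (z - z₀) ^ N) z :=
          (hg z hz).div (by fun_prop) (pow_ne_zero _ (sub_ne_zero.2 h))
        refine h1.congr ?_
        filter_upwards [isOpen_ne.mem_nhds h] with w hw using (hGne w hw).symm
    have hgG : ∀ z ∈ Metric.closedBall (0 : ℂ) 1, g z = (z - z₀) ^ N * G z := by
      intro z _
      rcases eq_or_ne z z₀ with rfl | h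
      · rw [hG0, hev.self_of_nhds, smul_eq_mul]
      · rw [hGne z h, mul_div_cancel₀ _ (pow_ne_zero _ (sub_ne_zero.2 h))]
    have hset : {z ∈ Metric.closedBall (0 : ℂ) 1 | G z = 0}
        = {z ∈ Metric.closedBall (0 : ℂ) 1 | g z = 0} \ {z₀} := by
      ext z
      rcases eq_or_ne z z₀ with rfl | h
      · simp [hG0, hg₁0]
      · simp [hGne z h, h, sub_eq_zero]
    have hneG : ¬∀ z ∈ Metric.closedBall (0 : ℂ) 1, G z = 0 := fun h =>
      hg₁0 (hG0 ▸ h z₀ hz₀)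
    obtain ⟨hfin', hloc'⟩ := (zeros_finite_or_eqOn_zero hGa).resolve_left hneG
    obtain ⟨s, u, hu, hu0, hs⟩ := ih hGa hneG hfin' hloc' (by
      rw [hset, Set.ncard_sdiff_singleton_of_mem 
        (show z₀ ∈ {z ∈ Metric.closedBall (0 : ℂ) 1 | g z = 0} from ⟨hz₀, hgz₀⟩), hk,
        Nat.add_sub_cancel])
    refine ⟨Multiset.replicate N z₀ + s, u, hu, hu0, fun z hz => ?_⟩
    rw [hgG z hz, hs z hz]
    simp [mul_assoc]

/-- Every holomorphic function on the closed disk is a constant multiple of a product of linear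
factors and an exponential. The number of linear factors can be chosen arbitrarily large. -/
theorem exists_eq_mul_prod_mul_exp {g : ℂ → ℂ}
    (hg : AnalyticOnNhd ℂ g (Metric.closedBall 0 1)) :
    ∃ k : ℕ, ∀ N, k ≤ N → ∃ (c : ℂ) (α : Fin N → ℂ) (h : ℂ → ℂ),
      AnalyticOnNhd ℂ h (Metric.closedBall 0 1) ∧
      ∀ z ∈ Metric.closedBall (0 : ℂ) 1, g z = c * (∏ j, (z - α j)) * Complex.exp (h z) := by
  by_cases h0 : ∀ z ∈ Metric.closedBall (0 : ℂ) 1, g z = 0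
  · exact ⟨0, fun N _ => ⟨0, 0, 0, analyticOnNhd_const, fun z hz => by simp [h0 z hz]⟩⟩
  obtain ⟨s, u, hu, hu0, hs⟩ := exists_eq_prod_mul hg h0
  refine ⟨Multiset.card s, fun N hN => ?_⟩
  -- The point 2 lies outside the disk, so factors z − 2 are units: they pad the product to length N
  -- and are compensated in the exponential.
  have h2 : ∀ z ∈ Metric.closedBall (0 : ℂ) 1, z - 2 ≠ 0 := by
    intro z hz h
    rw [sub_eq_zero] at h
    norm_num [h] at hz
  obtain ⟨h, hh, hexp⟩ := exists_eq_exp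
    (u := fun z => u z / (z - 2) ^ (N - Multiset.card s))
    (fun z hz => (hu z hz).div (by fun_prop) (pow_ne_zero _ (h2 z hz)))
    (fun z hz => div_ne_zero (hu0 z hz) (pow_ne_zero _ (h2 z hz)))
  obtain ⟨l, hl⟩ : ∃ l : List ℂ, (l : Multiset ℂ) = s + Multiset.replicate (N - Multiset.card s) 2 :=
    ⟨_, Multiset.coe_toList _⟩
  have hlen : l.length = N := by
    have := congrArg Multiset.card hl
    simp only [Multiset.coe_card, Multiset.card_add,
      Multiset.card_replicate] at this
    omega
  subst hlen
  refine ⟨1, l.get, h, hh, fun z hz => ?_⟩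
  have hprod : ∏ j, (z - l.get j) = (s.map fun α => z - α).prod *
      (z - 2) ^ (l.length - Multiset.card s) := by
    have := congrArg (fun t : Multiset ℂ => (t.map fun α => z - α).prod) hl
    simp only [Multiset.map_coe, Multiset.prod_coe, Multiset.map_add,
      Multiset.prod_add, Multiset.map_replicate, Multiset.prod_replicate] at this
    rw [← this, ← List.prod_ofFn]
    congr 1
    conv_rhs => rw [← List.ofFn_get l]
    rw [List.map_ofFn]; rfl
  rw [hprod, ← hexp z hz, hs z hz]
  have := pow_ne_zero (l.length - Multiset.card s) (h2 z hz)
  field_simp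

/-! ### Connectedness and interpolation in the parameter plane. -/

/-- A nonempty bounded convex open set is homeomorphic to the whole space, where complements of
countable sets are connected in real dimension above 1. -/
theorem _root_.Convex.isPreconnected_diff_countable {E : Type*} [NormedAddCommGroup E]
    [NormedSpace ℝ E] [FiniteDimensional ℝ E] (hE : 1 < Module.rank ℝ E) {s t : Set E}
    (hs : Convex ℝ s) (hso : IsOpen s) (hsb : Bornology.IsBounded s) (ht : t.Countable) :
    IsPreconnected (s \ t) := by
  rcases s.eq_empty_or_nonempty with rfl | hne
  · simp [isPreconnected_empty]
  obtain ⟨e, he, -, -⟩ := exists_homeomorph_image_interior_closure_frontier_eq_unitBall hs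
    (by rwa [hso.interior_eq]) hsb
  rw [hso.interior_eq] at he
  have hinj : Function.Injective fun x : E => e.symm (Homeomorph.unitBall x) :=
    e.symm.injective.comp (Subtype.val_injective.comp Homeomorph.unitBall.injective)
  have hcont : Continuous fun x : E => e.symm (Homeomorph.unitBall x) :=
    e.symm.continuous.comp (continuous_subtype_val.comp Homeomorph.unitBall.continuous)
  have hrange : range (fun x : E => e.symm (Homeomorph.unitBall x)) = s := by
    rw [show (fun x : E => e.symm (Homeomorph.unitBall x)) =
      e.symm ∘ (Subtype.val ∘ Homeomorph.unitBall) from rfl, range_comp,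
      Homeomorph.unitBall.surjective.range_comp, Subtype.range_coe, ← he]
    simp [image_image]
  have hpre := ((ht.preimage_of_injOn hinj.injOn).isConnected_compl_of_one_lt_rank hE).isPreconnected
  have := hpre.image _ hcont.continuousOn
  rwa [← preimage_compl, image_preimage_eq_inter_range, hrange, inter_comm, ← sdiff_eq] at this

section Interpolation

open Polynomial

/-- Interpolation by polynomials that are nonzero and pairwise distinct. -/
theorem exists_interpolating_polynomials {ι κ : Type*} [Fintype ι] [Countable κ]
    {x : ι → ℂ} (hx : Function.Injective x) (y : κ → ι → ℂ) :
    ∃ p : κ → ℂ[X], (∀ k l, (p k).eval (x l) = y k l) ∧ (∀ k, p k ≠ 0) ∧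
      Function.Injective p := by
  classical
  obtain ⟨d, hd⟩ := exists_injective_nat κ
  -- The interpolants have degree below that of the nodal polynomial, so the multiple of the latter
  -- can be read off.
  have key : ∀ (r r' : ι → ℂ) (b b' : ℂ),
      Lagrange.interpolate Finset.univ x r + Lagrange.nodal Finset.univ x * C b =
        Lagrange.interpolate Finset.univ x r' + Lagrange.nodal Finset.univ x * C b' → b = b' := by
    intro r r' b b' h
    by_contra hne
    have h1 : Lagrange.interpolate Finset.univ x (r - r') =
        Lagrange.nodal Finset.univ x * C (b' - b) := by
      rw [map_sub, C_sub]
      linear_combination h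
    have h2 := Lagrange.degree_interpolate_lt (s := Finset.univ) (v := x) (r - r') hx.injOn
    rw [h1, degree_mul, Lagrange.degree_nodal, degree_C (sub_ne_zero.2 (Ne.symm hne)),
      add_zero] at h2
    exact lt_irrefl _ h2
  -- Multiples of the nodal polynomial do not affect the values at the nodes; the shift by 1 makes
  -- the distinct coefficients nonzero as well.
  refine ⟨fun k => Lagrange.interpolate Finset.univ x (y k) +
    Lagrange.nodal Finset.univ x * C ((d k : ℂ) + 1), fun k l => ?_, fun k hk => ?_,
    fun k k' h => ?_⟩
  · rw [eval_add, eval_mul, Lagrange.eval_nodal_at_node (Finset.mem_univ l), zero_mul, add_zero,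
      Lagrange.eval_interpolate_at_node _ hx.injOn (Finset.mem_univ l)]
  · have := key (y k) 0 ((d k : ℂ) + 1) 0 (by simpa using hk)
    exact Nat.cast_add_one_ne_zero (d k) this
  · have := key _ _ _ _ h
    exact hd (by simpa using this)

end Interpolation

/-! ### Open subsets of affine space as irreducible complex spaces. -/

section OpenSubset

variable {N : ℕ} {Ω : Set (Fin N → ℂ)}

/-- The tautological chart of an open subset of affine space. -/
def openChart (hΩ : IsOpen Ω) : AnalyticChart Ω where
  dim := N
  source := univ
  isOpen_source := isOpen_univ
  domain := Ω
  isOpen_domain := hΩ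
  toFun := Subtype.val
  isEmbedding := Topology.IsEmbedding.subtypeVal.comp Topology.IsEmbedding.subtypeVal
  isAnalyticSubset_image := by
    refine ⟨by simp, fun x hx => ⟨Ω, hΩ, hx, subset_rfl, 0, 0, analyticOnNhd_const, ?_⟩⟩
    simp

/-- An open subset of affine space as a complex space. -/
def openComplexSpace (hΩ : IsOpen Ω) : ComplexSpace Ω where
  t2Space := inferInstance
  secondCountable := inferInstance
  atlas := {openChart hΩ}
  cover := fun _ => ⟨_, rfl, trivial⟩
  compatible := by
    rintro c rfl d rfl x -
    exact ⟨univ, id, isOpen_univ, trivial, analyticOnNhd_id, fun y _ _ => rfl⟩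

theorem IsAnalyticSubset.isClosed_preimage {A : Set (Fin N → ℂ)} (hA : IsAnalyticSubset Ω A) :
    IsClosed ((↑) ⁻¹' A : Set Ω) := by
  rw [← isOpen_compl_iff, isOpen_iff_mem_nhds]
  intro x hx
  obtain ⟨U, hU, hxU, -, k, f, hf, hAU⟩ := hA.2 x x.2
  have hfx : f x ≠ 0 := fun h => hx (hAU.symm.subset ⟨hxU, h⟩).1
  have : ∀ᶠ y in nhds (x : Fin N → ℂ), y ∉ A := by
    filter_upwards [hU.mem_nhds hxU, (hf x hxU).continuousAt.eventually_ne hfx] with y hy hy0 hyA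
    exact hy0 (hAU.subset ⟨hyA, hy⟩).2
  exact continuous_subtype_val.continuousAt.eventually this

/-- The identity theorem for analytic subsets. -/
theorem IsAnalyticSubset.eq_of_isPreconnected {A : Set (Fin N → ℂ)} (hA : IsAnalyticSubset Ω A)
    (hΩ : IsPreconnected Ω) (hne : (interior A).Nonempty) : A = Ω := by
  refine hA.1.antisymm ?_
  have hsub : Ω ⊆ interior A := by
    -- The interior of A is relatively closed: near a limit point the local equations vanish on an
    -- open part of a ball, hence on the ball.
    refine hΩ.subset_of_closure_inter_subset isOpen_interior ?_ ?_
    · obtain ⟨x, hx⟩ := hne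
      exact ⟨x, hA.1 (interior_subset hx), hx⟩
    · rintro x ⟨hxcl, hxΩ⟩
      obtain ⟨U, hU, hxU, -, k, f, hf, hAU⟩ := hA.2 x hxΩ
      obtain ⟨r, hr, hball⟩ := Metric.isOpen_iff.1 hU x hxU
      obtain ⟨y, hy, hyA⟩ := mem_closure_iff.1 hxcl _ Metric.isOpen_ball (Metric.mem_ball_self hr)
      have hev : f =ᶠ[nhds y] 0 := by
        filter_upwards [isOpen_interior.mem_nhds hyA, Metric.isOpen_ball.mem_nhds hy] with z hz hzb
        exact (hAU.subset ⟨interior_subset hz, hball hzb⟩).2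
      have h0 := (hf.mono hball).eqOn_zero_of_preconnected_of_eventuallyEq_zero
        (convex_ball x r).isPreconnected hy hev
      refine mem_interior.2 ⟨Metric.ball x r, fun z hz => ?_, Metric.isOpen_ball,
        Metric.mem_ball_self hr⟩
      exact (hAU.symm.subset ⟨hball hz, h0 hz⟩).1
  exact hsub.trans interior_subset

/-- If one analytic set is proper, its complement is a nonempty open subset of the other, which is
then everything by the identity theorem. -/
theorem openComplexSpace_isIrreducible (hΩ : IsOpen Ω) (hconn : IsConnected Ω) :
    (openComplexSpace hΩ).IsIrreducible := by
  refine ⟨hconn.nonempty.to_subtype, fun Y₁ Y₂ h₁ h₂ hun => ?_⟩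
  have key : ∀ Y : Set Ω, (openComplexSpace hΩ).IsAnalyticSet Y →
      IsAnalyticSubset Ω ((↑) '' Y : Set (Fin N → ℂ)) := by
    intro Y hY
    have := hY (openChart hΩ) rfl
    simpa [openChart] using this
  by_contra! hne
  obtain ⟨x, hx⟩ := (ne_univ_iff_exists_notMem _).1 hne.1
  have hcl := (key Y₁ h₁).isClosed_preimage
  rw [preimage_image_eq _ Subtype.val_injective] at hcl
  have hopen : IsOpen ((↑) '' Y₁ᶜ : Set (Fin N → ℂ)) := hΩ.isOpenMap_subtype_val _ hcl.isOpen_compl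
  have hsub : Y₁ᶜ ⊆ Y₂ := fun y hy => ((hun.symm ▸ mem_univ y : y ∈ Y₁ ∪ Y₂)).resolve_left hy
  have heq := (key Y₂ h₂).eq_of_isPreconnected hconn.isPreconnected
    ⟨x, mem_interior.2 ⟨_, image_mono hsub, hopen, mem_image_of_mem _ hx⟩⟩
  apply hne.2
  rw [← preimage_image_eq Y₂ Subtype.val_injective, heq]
  simp

/-- A family over an open subset that is locally given by holomorphic functions of
`(v, t)` is holomorphic. -/
theorem openComplexSpace_isHolomorphicFamily (hΩ : IsOpen Ω) {n : ℕ}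
    {F : Ω → C(ClosedDisk, Fin n → ℂ)} {G : (Fin N → ℂ) × ℂ → Fin n → ℂ}
    (hG : ∀ v ∈ Ω, ∀ t : ClosedDisk, AnalyticAt ℂ G (v, (t : ℂ)))
    (hF : ∀ v t, F v t = G (v, (t : ℂ))) :
    (openComplexSpace hΩ).IsHolomorphicFamily F := by
  rintro c rfl v - t
  exact ⟨{p | AnalyticAt ℂ G p}, G, isOpen_analyticAt ℂ G, hG v v.2 t, fun p hp => hp,
    fun w _ s _ => hF w s⟩

end OpenSubset

/-! ### Normal form of equivariant arcs. -/

theorem polydisk_eq_ball (n : ℕ) : polydisk n = Metric.ball (0 : Fin n → ℂ) 1 := by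
  ext x
  simp [polydisk, pi_norm_lt_iff]

theorem ClosedDisk.norm_le (t : ClosedDisk) : ‖(t : ℂ)‖ ≤ 1 :=
  mem_closedBall_zero_iff.1 t.2

/-- Characters of `ℤ/m` are given by powers of a primitive root of unity. -/
theorem exists_exponents {n m : ℕ} (hm : 0 < m) {ε : ℂ} (hε : IsPrimitiveRoot ε m)
    (ρ : Fin n → (Multiplicative (ZMod m) →* ℂˣ)) :
    ∃ a : Fin n → ℕ, (∀ i, 1 ≤ a i ∧ a i ≤ m) ∧
      ∀ i (k : ZMod m), (ρ i (Multiplicative.ofAdd k) : ℂ) = (ε ^ k.val) ^ a i := by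
  have : NeZero m := ⟨hm.ne'⟩
  have h : ∀ i, ∃ b : ℕ, (1 ≤ b ∧ b ≤ m) ∧ (ρ i (Multiplicative.ofAdd 1) : ℂ) = ε ^ b := by
    intro i
    have h1 : ((ρ i (Multiplicative.ofAdd 1) : ℂˣ) : ℂ) ^ m = 1 := by
      rw [← Units.val_pow_eq_pow_val, ← map_pow, ← ofAdd_nsmul]
      simp
    obtain ⟨b, hb, hbe⟩ := hε.eq_pow_of_pow_eq_one h1
    rcases Nat.eq_zero_or_pos b with rfl | hb0
    -- The trivial character gets exponent m instead of 0, so that the monomial vanishes at the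
    -- origin.
    · exact ⟨m, ⟨hm, le_rfl⟩, by rw [hε.pow_eq_one, ← hbe, pow_zero]⟩
    · exact ⟨b, ⟨hb0, hb.le⟩, hbe.symm⟩
  choose a ha hρ using h
  refine ⟨a, ha, fun i k => ?_⟩
  rw [← pow_mul, mul_comm, pow_mul, ← hρ i, ← Units.val_pow_eq_pow_val, ← map_pow,
    ← ofAdd_nsmul]
  simp

variable {n m : ℕ} {ε : ℂ} {ρ : Fin n → (Multiplicative (ZMod m) →* ℂˣ)} {a : Fin n → ℕ}

theorem Equivariant.apply_mul (hm : 0 < m) (hε : IsPrimitiveRoot ε m)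
    (hρ : ∀ i (k : ZMod m), (ρ i (Multiplicative.ofAdd k) : ℂ) = (ε ^ k.val) ^ a i)
    {φ : C(ClosedDisk, Fin n → ℂ)} (hφ : φ ∈ Equivariant ε ρ) {s t : ClosedDisk}
    (hst : (s : ℂ) = ε * t) (i : Fin n) : φ s i = ε ^ a i * φ t i := by
  -- For m = 1 the representative of 1 is 0, so the exponents agree only modulo m.
  have h1 : ε ^ (1 : ZMod m).val = ε := by
    rw [ZMod.val_one_eq_one_mod]
    conv_rhs => rw [← pow_one ε]
    rw [(hε.isOfFinOrder hm.ne').pow_inj_mod, ← hε.eq_orderOf, Nat.mod_mod]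
  rw [hφ 1 s t (by rw [h1, hst]) i, hρ, h1]

theorem mem_equivariant_of_eq_pow_mul (hε : IsPrimitiveRoot ε m)
    (hρ : ∀ i (k : ZMod m), (ρ i (Multiplicative.ofAdd k) : ℂ) = (ε ^ k.val) ^ a i)
    {φ : C(ClosedDisk, Fin n → ℂ)} {g : Fin n → ℂ → ℂ}
    (h : ∀ (t : ClosedDisk) i, φ t i = (t : ℂ) ^ a i * g i ((t : ℂ) ^ m)) :
    φ ∈ Equivariant ε ρ := by
  intro k s t hst i
  have : (s : ℂ) ^ m = (t : ℂ) ^ m := by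
    rw [hst, mul_pow, pow_right_comm, hε.pow_eq_one, one_pow, one_mul]
  rw [h, h, this, hst, mul_pow, hρ, mul_assoc]

theorem exists_eq_pow_mul_of_mem (hm : 0 < m) (hε : IsPrimitiveRoot ε m)
    (ha : ∀ i, 1 ≤ a i ∧ a i ≤ m)
    (hρ : ∀ i (k : ZMod m), (ρ i (Multiplicative.ofAdd k) : ℂ) = (ε ^ k.val) ^ a i)
    {φ : C(ClosedDisk, Fin n → ℂ)} (hφ : φ ∈ arcZero n ∩ Equivariant ε ρ) (i : Fin n) :
    ∃ g : ℂ → ℂ, AnalyticOnNhd ℂ g (Metric.closedBall 0 1) ∧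
      ∀ t : ClosedDisk, φ t i = (t : ℂ) ^ a i * g ((t : ℂ) ^ m) := by
  obtain ⟨⟨⟨⟨f, hf, hφf⟩, -⟩, hφ0⟩, hφe⟩ := hφ
  have hε1 : ‖ε‖ = 1 := hε.norm'_eq_one hm.ne'
  obtain ⟨g, hg, hfg⟩ := exists_eq_pow_mul_comp_pow hm hε (ha i).2 (f := fun z => f z i)
    (fun z hz => (analyticAt_pi_iff.1 (hf z hz)) i)
    (by have := hφ0 i; rwa [hφf] at this)
    (by
      intro t ht
      have := Equivariant.apply_mul hm hε hρ hφe (s := ⟨ε * t, by simpa [hε1] using ht⟩)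
        (t := ⟨t, by simpa using ht⟩) rfl i
      rwa [hφf, hφf] at this)
  exact ⟨g, hg, fun t => by rw [hφf]; exact hfg t t.norm_le⟩

/-- Arcs whose components are given by a monomial, linear factors without common zeros, and an
exponential. -/
theorem mem_sharcStar_of_eq (ha : ∀ i, 1 ≤ a i) {N : ℕ}
    {φ : C(ClosedDisk, Fin n → ℂ)} {c : Fin n → ℂ} {α : Fin n → Fin N → ℂ} {h : Fin n → ℂ → ℂ}
    (hc : ∀ i, c i ≠ 0) (hα : ∀ i i' j j', i ≠ i' → α i j ≠ α i' j')
    (hh : ∀ i, AnalyticOnNhd ℂ (h i) (Metric.closedBall 0 1))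
    (hφ : ∀ (t : ClosedDisk) i, φ t i =
      (t : ℂ) ^ a i * (c i * (∏ j, ((t : ℂ) ^ m - α i j)) * Complex.exp (h i ((t : ℂ) ^ m))))
    (hφ1 : ∀ t, φ t ∈ polydisk n) (hn : 2 ≤ n) :
    φ ∈ sharcStar n := by
  have h0 : ∀ i, φ origin i = 0 := fun i => by
    rw [hφ, origin, zero_pow (by have := ha i; omega), zero_mul]
  refine ⟨⟨⟨⟨fun z i => z ^ a i * (c i * (∏ j, (z ^ m - α i j)) * Complex.exp (h i (z ^ m))),
    ?_, fun t => funext (hφ t)⟩, hφ1⟩, h0⟩, ?_⟩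
  · intro z hz
    rw [analyticAt_pi_iff]
    intro i
    have h1 : AnalyticAt ℂ (fun z => h i (z ^ m)) z := by
      have hzm : z ^ m ∈ Metric.closedBall (0 : ℂ) 1 := by
        simpa using pow_le_one₀ (norm_nonneg z) (by simpa using hz)
      exact AnalyticAt.fun_comp (hh i _ hzm) (by fun_prop)
    have h2 : AnalyticAt ℂ (fun z => ∏ j, (z ^ m - α i j)) z :=
      Finset.analyticAt_fun_prod _ fun j _ => by fun_prop
    have h3 : AnalyticAt ℂ (fun z : ℂ => z ^ a i) z := by fun_prop
    exact h3.mul ((analyticAt_const.mul h2).mul h1.cexp)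
  · ext t
    simp only [mem_preimage, mem_singleton_iff]
    constructor
    · rintro ⟨-, i, i', hii, hi, hi'⟩
      by_contra ht
      have ht0 : (t : ℂ) ≠ 0 := fun h => ht (Subtype.ext h)
      have hroot : ∀ i, φ t i = 0 → ∃ j, (t : ℂ) ^ m = α i j := by
        intro i hi
        rw [hφ] at hi
        simpa [ht0, hc i, Finset.prod_eq_zero_iff, sub_eq_zero] using hi
      obtain ⟨j, hj⟩ := hroot i hi
      obtain ⟨j', hj'⟩ := hroot i' hi'
      exact hα i i' j j' hii (hj.symm.trans hj')
    · rintro rfl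
      exact ⟨hφ1 _, ⟨0, by omega⟩, ⟨1, by omega⟩, by simp, h0 _, h0 _⟩

/-! ### Holomorphic families through finitely many arcs. -/

/-- A continuous family of maps to a normed space whose members at finitely many real parameters
take values in the unit ball can be rescaled, without changing these members, so that
the values are in the unit ball for all parameters in a convex domain. -/
theorem exists_scaling {ι D E : Type*} [Fintype ι] [TopologicalSpace D] [CompactSpace D]
    [NormedAddCommGroup E] [NormedSpace ℂ E] {Φ : ℂ × D → E} (hΦ : Continuous Φ) (x : ι → ℝ)
    (hx : ∀ l t, ‖Φ (x l, t)‖ < 1) :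
    ∃ (e : ℂ → ℂ) (V : Set ℂ), Differentiable ℂ e ∧ (∀ v, e v ≠ 0) ∧ (∀ l, e (x l) = 1) ∧
      IsOpen V ∧ Convex ℝ V ∧ Bornology.IsBounded V ∧ V.Nonempty ∧ (∀ l, (x l : ℂ) ∈ V) ∧
      ∀ v ∈ V, ∀ t, ‖e v • Φ (v, t)‖ < 1 := by
  set M : ℝ := ∑ l, |x l|
  have hM : 0 ≤ M := Finset.sum_nonneg fun l _ => abs_nonneg _
  have hxM : ∀ l, x l ∈ Icc (-M) M := fun l =>
    abs_le.1 (Finset.single_le_sum (f := fun l => |x l|) (fun l _ => abs_nonneg _)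
      (Finset.mem_univ l))
  -- The square makes q nonnegative on the real line, with zeros exactly at the parameters; exp(−k
  -- q) is then 1 there and tends to 0 elsewhere as k grows.
  set q : ℝ → ℝ := fun r => (∏ l, (r - x l)) ^ 2 with hq
  have hqc : Continuous q := by fun_prop
  have hq0 : ∀ r, 0 ≤ q r := fun r => sq_nonneg _
  have hcover : (Icc (-M) M ×ˢ (univ : Set D)) ⊆
      ⋃ k : ℕ, {p : ℝ × D | Real.exp (-(k * q p.1)) * ‖Φ (p.1, p.2)‖ < 1} := by
    rintro ⟨r, t⟩ -
    rw [mem_iUnion]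
    rcases (hq0 r).eq_or_lt with h | h
    · have h' : ∏ l, (r - x l) = 0 := by simpa [hq] using h.symm
      obtain ⟨l, -, hl⟩ := Finset.prod_eq_zero_iff.1 h'
      refine ⟨0, ?_⟩
      rw [sub_eq_zero] at hl
      simpa [hl] using hx l t
    · have h1 : Filter.Tendsto (fun k : ℕ => Real.exp (-(k * q r)) * ‖Φ (r, t)‖) Filter.atTop
          (nhds (0 * ‖Φ (r, t)‖)) := by
        refine Filter.Tendsto.mul_const _ ?_
        exact Real.tendsto_exp_neg_atTop_nhds_zero.comp
          (tendsto_natCast_atTop_atTop.atTop_mul_const h)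
      rw [zero_mul] at h1
      exact (h1.eventually_lt_const one_pos).exists
  -- Compactness gives one k for the whole segment; the tube lemma below extends the bound to a
  -- complex neighbourhood.
  obtain ⟨k, hk⟩ := (isCompact_Icc.prod isCompact_univ).elim_directed_cover _
    (fun k => isOpen_lt (by fun_prop) continuous_const) hcover
    (Monotone.directed_le fun k k' hkk => by
      intro p hp
      rw [mem_ofPred_eq] at hp ⊢
      refine lt_of_le_of_lt ?_ hp
      have := hq0 p.1
      have hkk' : (k : ℝ) ≤ k' := by exact_mod_cast hkk
      gcongr)
  set e : ℂ → ℂ := fun v => Complex.exp (-(k * (∏ l, (v - x l)) ^ 2)) with he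
  have hed : Differentiable ℂ e := by fun_prop
  have her : ∀ r : ℝ, e r = (Real.exp (-(k * q r)) : ℂ) := fun r => by
    simp [he, hq]
  set S : Set ℂ := Complex.ofReal '' Icc (-M) M
  have hScomp : IsCompact S := isCompact_Icc.image Complex.continuous_ofReal
  have hSconv : Convex ℝ S := (convex_Icc _ _).linear_image Complex.ofRealCLM.toLinearMap
  obtain ⟨u, w, huo, -, hSu, huw, hsub⟩ := generalized_tube_lemma hScomp (isCompact_univ (X := D))
    (n := {p | ‖e p.1 • Φ p‖ < 1}) (isOpen_lt (by have := hed.continuous; fun_prop) continuous_const)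
    (by
      rintro ⟨_, t⟩ ⟨⟨r, hr, rfl⟩, -⟩
      have := hk (mk_mem_prod hr (mem_univ t))
      simp only [mem_ofPred_eq] at this ⊢
      rwa [her, norm_smul, Complex.norm_real, Real.norm_eq_abs, Real.abs_exp])
  obtain ⟨δ, hδ, hthick⟩ := hScomp.exists_thickening_subset_open huo hSu
  have hmem : ∀ r ∈ Icc (-M) M, (r : ℂ) ∈ Metric.thickening δ S := fun r hr =>
    Metric.self_subset_thickening hδ _ (mem_image_of_mem _ hr)
  have hlt : ∀ v ∈ Metric.thickening δ S, ∀ t, ‖e v • Φ (v, t)‖ < 1 := fun v hv t => by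
    have := hsub (mk_mem_prod (hthick hv) (huw (mem_univ t)))
    rwa [mem_ofPred_eq] at this
  have hex : ∀ l, e (x l) = 1 := fun l => by
    simp [he, Finset.prod_eq_zero (Finset.mem_univ l)]
  exact ⟨e, Metric.thickening δ S, hed, fun v => Complex.exp_ne_zero _,
    hex, Metric.isOpen_thickening,
    hSconv.thickening δ, hScomp.isBounded.thickening,
    ⟨_, hmem 0 ⟨by linarith, hM⟩⟩, fun l => hmem _ (hxM l),
    hlt⟩

theorem analyticAt_eval_fst (p : Polynomial ℂ) (q : ℂ × ℂ) :
    AnalyticAt ℂ (fun q : ℂ × ℂ => p.eval q.1) q :=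
  AnalyticAt.fun_comp (AnalyticOnNhd.eval_polynomial p _ trivial) analyticAt_fst

/-- The parameters where a finite family of distinct nonzero polynomials has a zero or a
coincidence. -/
theorem finite_zeros_or_coincidences {κ : Type*} [Finite κ] {p : κ → Polynomial ℂ}
    (hp0 : ∀ k, p k ≠ 0) (hp : Function.Injective p) :
    {v : ℂ | (∃ k, (p k).eval v = 0) ∨ ∃ k k', k ≠ k' ∧ (p k).eval v = (p k').eval v}.Finite := by
  have h1 : (⋃ k, {v | (p k).IsRoot v}).Finite :=
    finite_iUnion fun k => Polynomial.finite_setOfPred_isRoot (hp0 k)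
  have h2 : (⋃ k : {k : κ × κ // k.1 ≠ k.2}, {v | (p k.1.1 - p k.1.2).IsRoot v}).Finite :=
    finite_iUnion fun k => Polynomial.finite_setOfPred_isRoot (sub_ne_zero.2 (hp.ne k.2))
  refine (h1.union h2).subset ?_
  rintro v (⟨k, hk⟩ | ⟨k, k', hkk, hv⟩)
  · exact Or.inl (mem_iUnion.2 ⟨k, hk⟩)
  · exact Or.inr (mem_iUnion.2 ⟨⟨(k, k'), hkk⟩, by simp [hv]⟩)

/-- Finitely many short arcs belong to a holomorphic family of short arcs over a connected open
set. -/
theorem exists_family (hn : 2 ≤ n) (hm : 0 < m) (hε : IsPrimitiveRoot ε m)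
    (ha : ∀ i, 1 ≤ a i ∧ a i ≤ m)
    (hρ : ∀ i (k : ZMod m), (ρ i (Multiplicative.ofAdd k) : ℂ) = (ε ^ k.val) ^ a i)
    {P : Set C(ClosedDisk, Fin n → ℂ)} (hP : P.Finite)
    (hPA : P ⊆ sharcStar n ∩ Equivariant ε ρ) :
    ∃ (Ω : Set (Fin 1 → ℂ)) (hΩ : IsOpen Ω) (F : Ω → C(ClosedDisk, Fin n → ℂ)),
      IsConnected Ω ∧ Continuous F ∧ (openComplexSpace hΩ).IsHolomorphicFamily F ∧
      range F ⊆ sharcStar n ∩ Equivariant ε ρ ∧ P ⊆ range F := by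
  classical
  have : Fintype P := hP.fintype
  choose g hg hφg using fun (φ : P) (i : Fin n) =>
    exists_eq_pow_mul_of_mem hm hε ha hρ (φ := φ) ⟨(hPA φ.2).1.1, (hPA φ.2).2⟩ i
  choose d hd using fun (φ : P) (i : Fin n) => exists_eq_mul_prod_mul_exp (hg φ i)
  obtain ⟨N, hN⟩ : ∃ N : ℕ, ∀ φ i, d φ i ≤ N :=
    ⟨∑ φ, ∑ i, d φ i, fun φ i => (Finset.single_le_sum (f := fun i => d φ i)
      (fun _ _ => Nat.zero_le _) (Finset.mem_univ i)).trans
      (Finset.single_le_sum (f := fun φ => ∑ i, d φ i) (fun _ _ => Nat.zero_le _)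
        (Finset.mem_univ φ))⟩
  choose c α h hh hgeq using fun φ i => hd φ i N (hN φ i)
  -- The nodes are real because the rescaling works along a real segment.
  set x : P → ℝ := fun φ => ((Fintype.equivFin P φ : ℕ) : ℝ)
  have hx : Function.Injective fun φ => (x φ : ℂ) := fun φ ψ hφψ => by
    simpa [x, Fin.val_inj] using hφψ
  obtain ⟨p, hpx, hp0, hpinj⟩ := exists_interpolating_polynomials
    (κ := Fin n ⊕ (Fin n × Fin N)) hx
    (Sum.elim (fun i φ => c φ i) (fun ij φ => α φ ij.1 ij.2))
  set L : P → Polynomial ℂ := fun φ => Lagrange.basis Finset.univ (fun φ => (x φ : ℂ)) φ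
  set H : ℂ → Fin n → ℂ → ℂ := fun v i s => ∑ φ, (L φ).eval v * h φ i s
  set Φ : ℂ × ℂ → Fin n → ℂ := fun q i => q.2 ^ a i * ((p (.inl i)).eval q.1 *
    (∏ j, (q.2 ^ m - (p (.inr (i, j))).eval q.1)) * Complex.exp (H q.1 i (q.2 ^ m)))
    with hΦ
  have hpow : ∀ t : ClosedDisk, (t : ℂ) ^ m ∈ Metric.closedBall (0 : ℂ) 1 := fun t => by
    simpa using pow_le_one₀ (norm_nonneg _) t.norm_le
  have hΦa : ∀ (v : ℂ) (t : ClosedDisk), AnalyticAt ℂ Φ (v, (t : ℂ)) := by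
    intro v t
    rw [analyticAt_pi_iff]
    intro i
    have h1 : AnalyticAt ℂ (fun q : ℂ × ℂ => H q.1 i (q.2 ^ m)) (v, (t : ℂ)) := by
      refine Finset.analyticAt_fun_sum _ fun φ _ => (analyticAt_eval_fst _ _).mul ?_
      exact AnalyticAt.fun_comp (g := h φ i) (f := fun q : ℂ × ℂ => q.2 ^ m) (hh φ i _ (hpow t))
        (analyticAt_snd.pow m)
    have h2 : AnalyticAt ℂ (fun q : ℂ × ℂ => ∏ j, (q.2 ^ m - (p (.inr (i, j))).eval q.1))
        (v, (t : ℂ)) :=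
      Finset.analyticAt_fun_prod _ fun j _ =>
        (analyticAt_snd.pow m).sub (analyticAt_eval_fst _ _)
    exact (analyticAt_snd.pow (a i)).mul (((analyticAt_eval_fst _ _).mul h2).mul h1.cexp)
  have hΦc : Continuous fun q : ℂ × ClosedDisk => Φ (q.1, (q.2 : ℂ)) :=
    continuous_iff_continuousAt.2 fun q =>
      ContinuousAt.comp (g := Φ) (f := fun q : ℂ × ClosedDisk => (q.1, (q.2 : ℂ)))
        (hΦa q.1 q.2).continuousAt (by fun_prop)
  have hΦx : ∀ (φ : P) (t : ClosedDisk), Φ (x φ, (t : ℂ)) = φ.1 t := by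
    intro φ t
    have hL : ∀ i s, H (x φ) i s = h φ i s := by
      intro i s
      simp only [H]
      rw [Finset.sum_eq_single φ]
      · rw [show (L φ).eval (x φ : ℂ) = 1 from
          Lagrange.eval_basis_self hx.injOn (Finset.mem_univ φ), one_mul]
      · intro ψ _ hne
        rw [show (L ψ).eval (x φ : ℂ) = 0 from
          Lagrange.eval_basis_of_ne (v := fun φ => (x φ : ℂ)) hne (Finset.mem_univ φ), zero_mul]
      · simp
    funext i
    rw [hφg, hgeq φ i _ (hpow t)]
    simp [hΦ, hpx, hL]
  obtain ⟨e, V, hed, he0, hex, hVo, hVc, hVb, hVne, hxV, hlt⟩ := exists_scaling hΦc x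
    (fun φ t => by
      have := (hPA φ.2).1.1.1.2 t
      rw [polydisk_eq_ball, mem_ball_zero_iff] at this
      rwa [hΦx])
  -- The nodes are kept even where the data degenerate (a zero component has c = 0, padding repeats
  -- α): there the member is an arc of P.
  set B : Set ℂ := {v : ℂ | (∃ k, (p k).eval v = 0) ∨
    ∃ k k', k ≠ k' ∧ (p k).eval v = (p k').eval v} \ range fun φ => (x φ : ℂ) with hB
  have hBfin : B.Finite := (finite_zeros_or_coincidences hp0 hpinj).sdiff
  have hVBne : (V \ B).Nonempty := by
    by_contra! hempty
    exact (infinite_of_mem_nhds _ (hVo.mem_nhds hVne.some_mem))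
      (hBfin.subset (sdiff_eq_empty.1 hempty))
  have hVB : IsConnected (V \ B) := ⟨hVBne,
    hVc.isPreconnected_diff_countable (by simp [Complex.rank_real_complex]) hVo hVb
      hBfin.countable⟩
  set E : ℂ ≃ₜ (Fin 1 → ℂ) := (Homeomorph.funUnique (Fin 1) ℂ).symm
  have hΩ : IsOpen {w : Fin 1 → ℂ | w 0 ∈ V \ B} :=
    (hVo.sdiff hBfin.isClosed).preimage (continuous_apply 0)
  have hΩc : IsConnected {w : Fin 1 → ℂ | w 0 ∈ V \ B} := by
    have := hVB.image E E.continuous.continuousOn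
    rw [E.image_eq_preimage_symm] at this
    exact this
  -- Currying a jointly continuous map yields continuity of the classifying map for the supremum
  -- metric.
  set K : C(ℂ × ClosedDisk, Fin n → ℂ) :=
    ⟨fun q => e q.1 • Φ (q.1, (q.2 : ℂ)), (hed.continuous.comp continuous_fst).smul hΦc⟩
  have hKform : ∀ v t i, K (v, t) i = (t : ℂ) ^ a i * ((e v * (p (.inl i)).eval v) *
    (∏ j, ((t : ℂ) ^ m - (p (.inr (i, j))).eval v)) * Complex.exp (H v i ((t : ℂ) ^ m))) := by
    intro v t i
    simp only [K, hΦ, ContinuousMap.coe_mk, Pi.smul_apply, smul_eq_mul]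
    ring
  have hKx : ∀ φ : P, K.curry (x φ) = φ.1 := by
    intro φ
    ext1 t
    simp [K, hex, hΦx]
  refine ⟨_, hΩ, fun w => K.curry (w.1 0), hΩc,
    K.curry.continuous.comp ((continuous_apply 0).comp continuous_subtype_val),
    openComplexSpace_isHolomorphicFamily hΩ (G := fun q => e (q.1 0) • Φ (q.1 0, q.2))
      (fun w _ t => ?_) (fun w t => rfl), ?_, fun φ hφ => ?_⟩
  · have hproj : AnalyticAt ℂ (fun q : (Fin 1 → ℂ) × ℂ => q.1 0) (w, (t : ℂ)) :=
      AnalyticAt.fun_comp (g := fun w : Fin 1 → ℂ => w 0)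
        ((ContinuousLinearMap.proj (R := ℂ) (φ := fun _ : Fin 1 => ℂ) 0).analyticAt _)
        analyticAt_fst
    refine AnalyticAt.fun_smul ?_ ?_
    · exact AnalyticAt.fun_comp (g := e) (f := fun q : (Fin 1 → ℂ) × ℂ => q.1 0)
        (hed.analyticAt _) hproj
    · exact AnalyticAt.fun_comp (g := Φ) (f := fun q : (Fin 1 → ℂ) × ℂ => (q.1 0, q.2))
        (hΦa (w 0) t) (hproj.prod analyticAt_snd)
  · rintro _ ⟨⟨w, hwV, hwB⟩, rfl⟩
    simp only
    by_cases hw : w 0 ∈ range fun φ => (x φ : ℂ)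
    · obtain ⟨φ, hφ⟩ := hw
      rw [← hφ, hKx]
      exact hPA φ.2
    have hgen : ¬ ((∃ k, (p k).eval (w 0) = 0) ∨
      ∃ k k', k ≠ k' ∧ (p k).eval (w 0) = (p k').eval (w 0)) := fun h => hwB ⟨h, hw⟩
    push Not at hgen
    constructor
    · refine mem_sharcStar_of_eq (m := m) (fun i => (ha i).1) (N := N)
        (c := fun i => e (w 0) * (p (.inl i)).eval (w 0))
        (α := fun i j => (p (.inr (i, j))).eval (w 0)) (h := H (w 0))
        (fun i => mul_ne_zero (he0 _) (hgen.1 _)) (fun i i' j j' hii => hgen.2 _ _ ?_)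
        (fun i s hs => ?_) (fun t i => hKform _ t i) (fun t => ?_) hn
      · simp [hii]
      · exact Finset.analyticAt_fun_sum _ fun φ _ => analyticAt_const.mul (hh φ i s hs)
      · rw [polydisk_eq_ball, mem_ball_zero_iff]
        exact hlt _ hwV t
    · exact mem_equivariant_of_eq_pow_mul hε hρ (g := fun i s => (e (w 0) * (p (.inl i)).eval (w 0)) *
        (∏ j, (s - (p (.inr (i, j))).eval (w 0))) * Complex.exp (H (w 0) i s))
        (fun t i => hKform (w 0) t i)
  · refine ⟨⟨fun _ => x ⟨φ, hφ⟩, hxV _, fun h => h.2 ⟨_, rfl⟩⟩, hKx ⟨φ, hφ⟩⟩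

/-! ### Density. -/

/-- Finitely many holomorphic functions on the closed disk have, after adding suitable small
constants, no common zeros. -/
theorem exists_add_const_no_common_zeros {n : ℕ} {g : Fin n → ℂ → ℂ}
    (hg : ∀ i, AnalyticOnNhd ℂ (g i) (Metric.closedBall 0 1)) {η : ℝ} (hη : 0 < η) :
    ∃ w : Fin n → ℂ, (∀ i, ‖w i‖ < η) ∧ ∀ i j, i ≠ j →
      ∀ s ∈ Metric.closedBall (0 : ℂ) 1, g i s + w i = 0 → g j s + w j ≠ 0 := by
  -- Nonvanishing at 0 is carried through the induction so that each perturbed function has finitely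
  -- many zeros; each of these zeros then excludes one value of the next constant.
  suffices h : ∀ S : Finset (Fin n), ∃ w : Fin n → ℂ, (∀ i, ‖w i‖ < η) ∧
      (∀ i ∈ S, g i 0 + w i ≠ 0) ∧ ∀ i ∈ S, ∀ j ∈ S, i ≠ j →
      ∀ s ∈ Metric.closedBall (0 : ℂ) 1, g i s + w i = 0 → g j s + w j ≠ 0 by
    obtain ⟨w, hw, -, h⟩ := h Finset.univ
    exact ⟨w, hw, fun i j => h i (Finset.mem_univ i) j (Finset.mem_univ j)⟩
  intro S
  induction S using Finset.induction_on with
  | empty => exact ⟨0, fun _ => by simpa, by simp, by simp⟩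
  | insert k S hk ih =>
    obtain ⟨w, hw, hw0, hwS⟩ := ih
    have hfin : ∀ j ∈ S, {s ∈ Metric.closedBall (0 : ℂ) 1 | g j s + w j = 0}.Finite := by
      intro j hj
      have han : AnalyticOnNhd ℂ (fun s => g j s + w j) (Metric.closedBall 0 1) :=
        fun s hs => (hg j s hs).add analyticAt_const
      refine ((zeros_finite_or_eqOn_zero han).resolve_left fun h => ?_).1
      exact hw0 j hj (h 0 (by simp))
    have hbad : ((⋃ j ∈ S, (fun s => -g k s) ''
        {s ∈ Metric.closedBall (0 : ℂ) 1 | g j s + w j = 0}) ∪ {-g k 0}).Finite :=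
      (S.finite_toSet.biUnion fun j hj => (hfin j hj).image _).union (finite_singleton _)
    obtain ⟨b, hbη, hb⟩ := ((infinite_of_mem_nhds (0 : ℂ)
      (Metric.ball_mem_nhds 0 hη)).sdiff hbad).nonempty
    have hb0 : g k 0 + b ≠ 0 := fun h => hb (Or.inr (by
      rw [mem_singleton_iff]; linear_combination h))
    have hbj : ∀ j ∈ S, ∀ s ∈ Metric.closedBall (0 : ℂ) 1, g j s + w j = 0 → g k s + b ≠ 0 :=
      fun j hj s hs hjs h => hb (Or.inl (mem_iUnion₂.2
        ⟨j, hj, s, ⟨hs, hjs⟩, by simp only; linear_combination -h⟩))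
    have hne : ∀ i ∈ S, i ≠ k := fun i hi h => hk (h ▸ hi)
    refine ⟨Function.update w k b, fun i => ?_, fun i hi => ?_, fun i hi j hj hij s hs => ?_⟩
    · rcases eq_or_ne i k with rfl | h
      · simpa using hbη
      · simpa [h] using hw i
    · rcases Finset.mem_insert.1 hi with rfl | hi
      · simpa using hb0
      · simpa [hne i hi] using hw0 i hi
    · rcases Finset.mem_insert.1 hi with rfl | hiS <;>
        rcases Finset.mem_insert.1 hj with rfl | hjS
      · exact absurd rfl hij
      · simp only [Function.update_self, Function.update_of_ne (hne j hjS)]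
        exact fun h h' => hbj j hjS s hs h' h
      · simp only [Function.update_self, Function.update_of_ne (hne i hiS)]
        exact hbj i hiS s hs
      · simp only [Function.update_of_ne (hne i hiS), Function.update_of_ne (hne j hjS)]
        exact hwS i hiS j hjS hij s hs

/-- Adding constants w_i to the g_i changes the arc by t^{a_i} w_i, which respects equivariance and
the value at 0. By compactness the norm of the arc is below 1, leaving room for small perturbations.
-/
theorem arcZero_subset_closure_sharcStar (hn : 2 ≤ n) (hm : 0 < m) (hε : IsPrimitiveRoot ε m)
    (ha : ∀ i, 1 ≤ a i ∧ a i ≤ m)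
    (hρ : ∀ i (k : ZMod m), (ρ i (Multiplicative.ofAdd k) : ℂ) = (ε ^ k.val) ^ a i) :
    arcZero n ∩ Equivariant ε ρ ⊆ closure (sharcStar n ∩ Equivariant ε ρ) := by
  intro φ hφ
  choose g hg hφg using fun i => exists_eq_pow_mul_of_mem hm hε ha hρ hφ i
  obtain ⟨⟨⟨⟨f, hf, hφf⟩, hφ1⟩, hφ0⟩, -⟩ := hφ
  have : Nonempty ClosedDisk := ⟨origin⟩
  have hnorm : ‖φ‖ < 1 := (ContinuousMap.norm_lt_iff φ one_pos).2 fun t => by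
    have := hφ1 t
    rwa [polydisk_eq_ball, mem_ball_zero_iff] at this
  rw [Metric.mem_closure_iff]
  intro δ hδ
  have hη : 0 < min δ (1 - ‖φ‖) := lt_min hδ (sub_pos.2 hnorm)
  obtain ⟨w, hw, hwg⟩ := exists_add_const_no_common_zeros hg hη
  set θ : C(ClosedDisk, Fin n → ℂ) := ⟨fun t i => (t : ℂ) ^ a i * w i, by fun_prop⟩
  have hθ : ‖θ‖ < min δ (1 - ‖φ‖) := by
    refine (ContinuousMap.norm_lt_iff θ hη).2 fun t => (pi_norm_lt_iff hη).2 fun i => ?_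
    refine lt_of_le_of_lt ?_ (hw i)
    simp only [θ, ContinuousMap.coe_mk, norm_mul, norm_pow]
    exact mul_le_of_le_one_left (norm_nonneg _) (pow_le_one₀ (norm_nonneg _) t.norm_le)
  have hform : ∀ (t : ClosedDisk) i,
      (φ + θ) t i = (t : ℂ) ^ a i * (g i ((t : ℂ) ^ m) + w i) := fun t i => by
    simp only [ContinuousMap.add_apply, Pi.add_apply, hφg, θ, ContinuousMap.coe_mk]
    ring
  have hpoly : ∀ t, (φ + θ) t ∈ polydisk n := fun t => by
    rw [polydisk_eq_ball, mem_ball_zero_iff]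
    calc ‖(φ + θ) t‖ ≤ ‖φ + θ‖ := (φ + θ).norm_coe_le_norm t
      _ ≤ ‖φ‖ + ‖θ‖ := norm_add_le _ _
      _ < 1 := by linarith [hθ.trans_le (min_le_right _ _)]
  have hzero : ∀ i, (φ + θ) origin i = 0 := fun i => by
    rw [hform, origin, zero_pow (by have := (ha i).1; omega), zero_mul]
  refine ⟨φ + θ, ⟨⟨⟨⟨⟨fun z i => f z i + z ^ a i * w i, fun z hz => ?_, fun t => ?_⟩, hpoly⟩,
    hzero⟩, ?_⟩, ?_⟩, ?_⟩
  · rw [analyticAt_pi_iff]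
    intro i
    have := analyticAt_pi_iff.1 (hf z hz) i
    fun_prop
  · funext i
    simp [θ, hφf]
  · ext t
    simp only [mem_preimage, mem_singleton_iff]
    constructor
    · rintro ⟨-, i, j, hij, hi, hj⟩
      by_contra ht
      have ht0 : (t : ℂ) ≠ 0 := fun h => ht (Subtype.ext h)
      have htm : (t : ℂ) ^ m ∈ Metric.closedBall (0 : ℂ) 1 := by
        simpa using pow_le_one₀ (norm_nonneg _) t.norm_le
      rw [hform] at hi hj
      exact hwg i j hij _ htm ((mul_eq_zero.1 hi).resolve_left (pow_ne_zero _ ht0))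
        ((mul_eq_zero.1 hj).resolve_left (pow_ne_zero _ ht0))
    · rintro rfl
      exact ⟨hpoly _, ⟨0, by omega⟩, ⟨1, by omega⟩, by simp, hzero _, hzero _⟩
  · exact mem_equivariant_of_eq_pow_mul hε hρ (g := fun i s => g i s + w i) hform
  · rw [dist_eq_norm, sub_add_cancel_left, norm_neg]
    exact hθ.trans_le (min_le_left _ _)

/-! ### Conclusion. -/

theorem sharcStar_subset_sharcZero (hn : 2 ≤ n) : sharcStar n ⊆ sharcZero n := by
  rintro φ ⟨⟨hφ, h0⟩, hpre⟩
  refine ⟨hφ, ?_⟩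
  ext t
  simp only [mem_preimage, mem_singleton_iff]
  constructor
  · intro ht
    have : t ∈ φ ⁻¹' codimTwoStrata n :=
      ⟨hφ.2 t, ⟨0, by omega⟩, ⟨1, by omega⟩, by simp, by simp [ht], by simp [ht]⟩
    rwa [hpre] at this
  · rintro rfl
    exact funext h0

theorem sharcZero_subset_arcZero : sharcZero n ⊆ arcZero n := by
  rintro φ ⟨hφ, hpre⟩
  have h : origin ∈ φ ⁻¹' {0} := hpre.symm ▸ rfl
  exact ⟨hφ, fun i => congrFun (mem_singleton_iff.1 h) i⟩

theorem equivariant_main (hn : 2 ≤ n) (hm : 0 < m) (hε : IsPrimitiveRoot ε m)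
    (ρ : Fin n → (Multiplicative (ZMod m) →* ℂˣ)) :
    IsConnected (sharcStar n ∩ Equivariant ε ρ) ∧
      StronglyIrreducible (sharcStar n ∩ Equivariant ε ρ) ∧
      (sharcStar n ∩ Equivariant ε ρ ⊆ arcZero n ∩ Equivariant ε ρ ∧
        arcZero n ∩ Equivariant ε ρ ⊆ closure (sharcStar n ∩ Equivariant ε ρ)) ∧
      IsConnected (sharcZero n ∩ Equivariant ε ρ) := by
  obtain ⟨a, ha, hρ⟩ := exists_exponents hm hε ρ
  have hconn : IsConnected (sharcStar n ∩ Equivariant ε ρ) := by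
    constructor
    -- The family through the empty set of arcs still has members, since its base is nonempty.
    · obtain ⟨Ω, hΩ, F, hΩc, -, -, hF, -⟩ := exists_family hn hm hε ha hρ finite_empty
        (empty_subset _)
      obtain ⟨w, hw⟩ := hΩc.nonempty
      exact ⟨_, hF ⟨⟨w, hw⟩, rfl⟩⟩
    · refine isPreconnected_of_forall_pair fun φ hφ ψ hψ => ?_
      obtain ⟨Ω, hΩ, F, hΩc, hFc, -, hF, hP⟩ := exists_family hn hm hε ha hρ (toFinite {φ, ψ})
        (pair_subset hφ hψ)
      have := isConnected_iff_connectedSpace.1 hΩc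
      exact ⟨range F, hF, hP (by simp), hP (by simp), isPreconnected_range hFc⟩
  have hdense := arcZero_subset_closure_sharcStar hn hm hε ha hρ
  refine ⟨hconn, fun P hP hPA => ?_, ⟨?_, hdense⟩, ?_⟩
  · obtain ⟨Ω, hΩ, F, hΩc, -, hFh, hF, hPF⟩ := exists_family hn hm hε ha hρ hP hPA
    exact ⟨Ω, inferInstance, openComplexSpace hΩ, F, openComplexSpace_isIrreducible hΩ hΩc, hFh,
      hF, hPF⟩
  · exact inter_subset_inter_left _ fun φ hφ => hφ.1
  -- A set between a connected set and its closure is connected.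
  · exact hconn.subset_closure (inter_subset_inter_left _ (sharcStar_subset_sharcZero hn))
      ((inter_subset_inter_left _ sharcZero_subset_arcZero).trans hdense)

theorem equivariant_trivial (n : ℕ) :
    Equivariant (1 : ℂ) (fun _ : Fin n => (1 : Multiplicative (ZMod 1) →* ℂˣ)) = univ := by
  refine eq_univ_of_forall fun φ k s t hst i => ?_
  have : s = t := Subtype.ext (by simpa using hst)
  simp [this]

end ArcSpace

theorem mainTheorem12 (n : ℕ) (hn : 2 ≤ n) :
    (IsConnected (ArcSpace.sharcStar n) ∧
      ArcSpace.StronglyIrreducible (ArcSpace.sharcStar n) ∧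
      (ArcSpace.sharcStar n ⊆ ArcSpace.arcZero n ∧
        ArcSpace.arcZero n ⊆ closure (ArcSpace.sharcStar n)) ∧
      IsConnected (ArcSpace.sharcZero n)) ∧
    ∀ (m : ℕ), 0 < m → ∀ ε : ℂ, IsPrimitiveRoot ε m →
      ∀ ρ : Fin n → (Multiplicative (ZMod m) →* ℂˣ),
        IsConnected (ArcSpace.sharcStar n ∩ ArcSpace.Equivariant ε ρ) ∧
        ArcSpace.StronglyIrreducible (ArcSpace.sharcStar n ∩ ArcSpace.Equivariant ε ρ) ∧
        (ArcSpace.sharcStar n ∩ ArcSpace.Equivariant ε ρ ⊆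
            ArcSpace.arcZero n ∩ ArcSpace.Equivariant ε ρ ∧
          ArcSpace.arcZero n ∩ ArcSpace.Equivariant ε ρ ⊆
            closure (ArcSpace.sharcStar n ∩ ArcSpace.Equivariant ε ρ)) ∧
        IsConnected (ArcSpace.sharcZero n ∩ ArcSpace.Equivariant ε ρ) := by
  refine ⟨?_, fun m hm ε hε ρ => ArcSpace.equivariant_main hn hm hε ρ⟩
  simpa only [ArcSpace.equivariant_trivial, Set.inter_univ] using
    ArcSpace.equivariant_main (n := n) hn one_pos IsPrimitiveRoot.one (fun _ => 1)
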